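/- An SR (Stable Roommates) instance $I$ consists of a finite set $A$ of $n$ agents in which every agent $a$ has a strict total preference order $\succ_a$ over all other agents; by convention every agent ranks itself below all other agents. A matching is a set of pairwise disjoint unordered pairs of agents; it is stable if there are no two distinct agents each of which is either unmatched or prefers the other to its partner. $I$ is solvable if it admits a stable matching, and unsolvable otherwise. A stable partition of $I$ is a permutation $\Pi$ of $A$ such that for every agent $a$ either $\Pi(a)=\Pi^{-1}(a)$ or $\Pi(a)\succ_a\Pi^{-1}(a)$, and such that there are no two distinct agents $a,b$ with $b\succ_a\Pi^{-1}(a)$ and $a\succ_b\Pi^{-1}(b)$. A cycle of $\Pi$ is odd if its length is odd; fixed points count as odd cycles (of length $1$). Theorem. Let $n\ge 2$ and let $I$ be an SR instance with $n$ agents. Then $I$ admits a stable partition, and all stable partitions of $I$ have the same set of odd cycles, denoted by $\mathcal O_I$. If $I$ is solvable, then $|\mathcal O_I|=0$ if $n$ is even and $|\mathcal O_I|=1$ if $n$ is odd. If $I$ is unsolvable, then $|\mathcal O_I|\ge 2$ if $n$ is even and $|\mathcal O_I|\ge 1$ if $n$ is odd. In all cases $$|\mathcal O_I|\le\left\lfloor\frac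 n3\right\rfloor+\bigl((n \bmod 3)\bmod 2\bigr).$$ These bounds are tight for every $n$: for every $n\ge2$ there is a solvable instance with $n$ agents, and there is an instance with $n$ agents that attains the upper bound; for every $n\ge3$ there is an unsolvable instance with $n$ agents that attains the lower bound ($|\mathcal O_I|=2$ if $n$ is even, $|\mathcal O_I|=1$ if $n$ is odd), and there is an unsolvable instance with $n$ agents that attains the upper bound. -/

import Mathlib

/-- A Stable Roommates instance with complete preferences on the set of agents `A`:
`prefers i j k` (that is, `j ≻_i k`) is, for every agent `i`, a strict total order on the
agents other than `i`. -/
structure SRInstance (A : Type*) where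
  prefers : A → A → A → Prop
  ne_of_prefers : ∀ i j k, prefers i j k → j ≠ i ∧ k ≠ i
  irrefl : ∀ i j, ¬ prefers i j j
  trans : ∀ i j k l, prefers i j k → prefers i k l → prefers i j l
  total : ∀ i j k, j ≠ i → k ≠ i → j ≠ k → prefers i j k ∨ prefers i k j

namespace SRInstance

variable {A : Type*} (I : SRInstance A)

/-- The preference of `i` over all agents, where `i` stands for itself (being alone) and is
ranked last: every other agent is better than being alone. -/
def StrictlyPrefers (i j k : A) : Prop :=
  I.prefers i j k ∨ (j ≠ i ∧ k = i)

/-- A matching: a set of unordered pairs of distinct agents, such that every agent lies in at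
most one of the pairs. -/
def IsMatching (M : Set (Sym2 A)) : Prop :=
  (∀ e ∈ M, ¬ e.IsDiag) ∧ ∀ a : A, ∀ e ∈ M, ∀ f ∈ M, a ∈ e → a ∈ f → e = f

/-- Agent `i` is unassigned in `M`, or prefers `j` to its partner in `M`. -/
def WouldSwitch (M : Set (Sym2 A)) (i j : A) : Prop :=
  (∀ k, s(i, k) ∉ M) ∨ ∃ k, s(i, k) ∈ M ∧ I.prefers i j k

/-- The distinct agents `i` and `j` form a blocking pair of `M`. -/
def Blocks (M : Set (Sym2 A)) (i j : A) : Prop :=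
  i ≠ j ∧ I.WouldSwitch M i j ∧ I.WouldSwitch M j i

/-- A stable matching: a matching without blocking pairs. -/
def IsStableMatching (M : Set (Sym2 A)) : Prop :=
  IsMatching M ∧ ∀ i j, ¬ I.Blocks M i j

/-- An instance is solvable if it admits a stable matching. -/
def Solvable : Prop :=
  ∃ M : Set (Sym2 A), I.IsStableMatching M

/-- A stable partition: a permutation of the agents such that every agent weakly prefers its
successor to its predecessor, and no two distinct agents strictly prefer each other to their
predecessors. -/
def IsStablePartition (P : Equiv.Perm A) : Prop :=
  (∀ i, P i = P.symm i ∨ I.StrictlyPrefers i (P i) (P.symm i)) ∧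
  ¬ ∃ i j, i ≠ j ∧ I.StrictlyPrefers i j (P.symm i) ∧ I.StrictlyPrefers j i (P.symm j)

/-- The odd cycles of a permutation, fixed points included as cycles of length one. The cycle
through `a` is the cyclic sequence `a, P a, P (P a), …`. -/
def oddCyclesOf (P : Equiv.Perm A) : Set (Cycle A) :=
  {c | (∃ a, c = Function.periodicOrbit P a) ∧ Odd c.length}

/-- The set `O_I` of the odd cycles that are common to all stable partitions of `I`. -/
def oddCycles : Set (Cycle A) :=
  {c | ∀ P : Equiv.Perm A, I.IsStablePartition P → c ∈ oddCyclesOf P}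

end SRInstance

/-! Read a permutation `P` as the perfect matching joining the left copy of `a` to the right copy of
`P a` in the bipartite double cover. Every stable partition is then a stable matching of the cover,
where joins and inversion are available.

Existence (`exists_rankStable`): joining a stable matching of the cover with its inverse yields one
whose successors are at least as good as its predecessors. Among these, take one with the worst
successors. Eliminating all its rotations at once and joining with the inverse again must return the
same permutation, which leaves no pair violating the stable partition condition.

Uniqueness (`RankStable.apply_eq_of_odd`): the median of `P`, `M` and `P⁻¹` is a stable matching of
the cover that chooses `P` or `P⁻¹` at each agent. Its choice persists two steps along a cycle of
length above two, hence all around an odd one. This dichotomy, applied to the inverse of a second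
stable partition, forces agreement.

The bounds are counting: solvability means that the only odd cycles are fixed points, there is at
most one fixed point, and the number of odd cycles has the parity of `n`. Tightness holds because
any permutation with at most one fixed point is a stable partition of some instance. -/

namespace SRInstance

open Function

/-! ### Stable matchings of the double cover and existence of stable partitions. -/

section Rank

variable {A : Type*} {r : A → A → ℕ}

/-- A permutation, seen as the perfect matching `a ↦ P a` of the bipartite double cover, is
stable with respect to the ranks `r` (smaller ranks are better). -/
def BiStable (r : A → A → ℕ) (P : Equiv.Perm A) : Prop :=
  ∀ a b, r a b < r a (P a) → r b (P.symm b) ≤ r b a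

/-- The stable partition property in terms of ranks. -/
def RankStable (r : A → A → ℕ) (P : Equiv.Perm A) : Prop :=
  (∀ i, r i (P i) ≤ r i (P.symm i)) ∧ ∀ i j, r i j < r i (P.symm i) → r j (P.symm j) ≤ r j i

theorem RankStable.biStable {P : Equiv.Perm A} (h : RankStable r P) : BiStable r P :=
  fun a b hab => h.2 a b (hab.trans_le (h.1 a))

theorem BiStable.symm {P : Equiv.Perm A} (h : BiStable r P) : BiStable r P.symm := by
  intro a b hab
  by_contra hc
  have := h b a (by simpa using hc)
  omega

/-- The join of two stable matchings of the bipartite double cover. -/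
theorem BiStable.exists_join [Finite A] (hr : ∀ a, Injective (r a)) {P Q : Equiv.Perm A}
    (hP : BiStable r P) (hQ : BiStable r Q) :
    ∃ N : Equiv.Perm A, BiStable r N ∧ (∀ a, r a (N a) = min (r a (P a)) (r a (Q a))) ∧
      ∀ a, r a (N.symm a) = max (r a (P.symm a)) (r a (Q.symm a)) := by
  classical
  let f : A → A := fun a => if r a (P a) ≤ r a (Q a) then P a else Q a
  have hf : ∀ a, (f a = P a ∧ r a (P a) ≤ r a (Q a)) ∨ (f a = Q a ∧ r a (Q a) < r a (P a)) := by
    intro a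
    by_cases h : r a (P a) ≤ r a (Q a)
    · exact Or.inl ⟨if_pos h, h⟩
    · exact Or.inr ⟨if_neg h, by omega⟩
  -- Two agents choosing the same partner from different matchings coincide: stability of each
  -- matching makes that partner weakly prefer the agent it has in the other one.
  have key : ∀ a a', P a = Q a' → r a (P a) ≤ r a (Q a) → r a' (Q a') < r a' (P a') →
      a = a' := by
    intro a a' h h1 h2
    by_contra hne
    have hlt : r a (P a) < r a (Q a) := by
      refine lt_of_le_of_ne h1 fun he => hne ?_
      exact Q.injective ((hr a he).symm.trans h)
    have e1 := hQ a (Q a') (by rw [← h]; exact hlt)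
    have e2 := hP a' (P a) (by rw [h]; exact h2)
    rw [Equiv.symm_apply_apply] at e1 e2
    rw [h] at e2
    exact hne (hr _ (le_antisymm e2 e1))
  have hinj : Injective f := by
    intro a a' h
    rcases hf a with ⟨e, h1⟩ | ⟨e, h1⟩ <;> rcases hf a' with ⟨e', h2⟩ | ⟨e', h2⟩ <;>
      rw [e, e'] at h
    · exact P.injective h
    · exact key a a' h h1 h2
    · exact (key a' a h.symm h2 h1).symm
    · exact Q.injective h
  let N : Equiv.Perm A := Equiv.ofBijective f (Finite.injective_iff_bijective.mp hinj)
  have hN : ∀ a, r a (N a) = min (r a (P a)) (r a (Q a)) := by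
    intro a
    change r a (f a) = _
    rcases hf a with ⟨e, h1⟩ | ⟨e, h1⟩ <;> rw [e] <;> omega
  have hNs : ∀ a, r a (N.symm a) = max (r a (P.symm a)) (r a (Q.symm a)) := by
    intro b
    obtain ⟨a, rfl⟩ := N.surjective b
    rw [Equiv.symm_apply_apply]
    change r (f a) a = max (r (f a) (P.symm (f a))) (r (f a) (Q.symm (f a)))
    rcases hf a with ⟨e, h1⟩ | ⟨e, h1⟩ <;> rw [e, Equiv.symm_apply_apply]
    · rcases h1.lt_or_eq with h | h
      · have := hQ a (P a) h
        omega
      · rw [hr a h, Equiv.symm_apply_apply]; simp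
    · have := hP a (Q a) h1
      omega
  refine ⟨N, ?_, hN, hNs⟩
  intro a b hab
  rw [hN] at hab
  have e1 := hP a b (by omega)
  have e2 := hQ a b (by omega)
  rw [hNs]
  omega

/-- The bipartite double cover has a stable matching. -/
theorem exists_biStable [Finite A] (hr : ∀ a, Injective (r a)) :
    ∃ P : Equiv.Perm A, BiStable r P := by
  classical
  have := Fintype.ofFinite A
  obtain ⟨K, hK⟩ : ∃ K, ∀ a b, r a b < K := by
    obtain ⟨K, hK⟩ := (Set.finite_range fun p : A × A => r p.1 p.2).bddAbove
    exact ⟨K + 1, fun a b => Nat.lt_succ_of_le (hK ⟨(a, b), rfl⟩)⟩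
  -- A state of deferred acceptance: `b` still accepts agents of rank at most `t b`. Either `b` has
  -- rejected nobody, or it holds the agent `c` of rank `t b`, whose favourite among those accepting
  -- it is `b`. A state of minimal sum is terminal.
  let Inv : (A → ℕ) → Prop := fun t => ∀ b, t b = K ∨
    ∃ c, r b c = t b ∧ ∀ b', r b' c ≤ t b' → r c b ≤ r c b'
  obtain ⟨t, ht, hmin⟩ : ∃ t, Inv t ∧ ∀ t', Inv t' → ∑ b, t b ≤ ∑ b, t' b := by
    have hne : {t | Inv t}.Nonempty := ⟨fun _ => K, fun _ => Or.inl rfl⟩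
    refine ⟨argminOn (fun t => ∑ b, t b) {t | Inv t} hne,
      argminOn_mem (fun t : A → ℕ => ∑ b, t b) {t | Inv t} hne, fun t' h => ?_⟩
    exact argminOn_le (fun t : A → ℕ => ∑ b, t b) {t | Inv t} h
  -- If everybody rejected `a`, all would hold different agents, so by finiteness somebody would
  -- hold `a`.
  have hacc : ∀ a, ∃ b, r b a ≤ t b := by
    intro a
    by_contra! hc
    have hex : ∀ b, ∃ c, r b c = t b ∧ ∀ b', r b' c ≤ t b' → r c b ≤ r c b' := fun b =>
      (ht b).resolve_left fun h => by have := hc b; have := hK b a; omega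
    choose c hc1 hc2 using hex
    have hinj : Injective c := by
      intro b b' h
      have e1 := hc2 b b' (by rw [h, hc1])
      have e2 := hc2 b' b (by rw [← h, hc1])
      rw [← h] at e2
      exact hr _ (le_antisymm e1 e2)
    obtain ⟨b, rfl⟩ := (Finite.injective_iff_surjective.mp hinj) a
    have := hc b
    have := hc1 b
    omega
  have hbest : ∀ a, ∃ b, r b a ≤ t b ∧ ∀ b', r b' a ≤ t b' → r a b ≤ r a b' := by
    intro a
    obtain ⟨b0, hb0⟩ := hacc a
    obtain ⟨b, hb, h⟩ := (Finset.univ.filter fun b => r b a ≤ t b).exists_min_image (r a)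
      ⟨b0, by simpa using hb0⟩
    exact ⟨b, by simpa using hb, fun b' hb' => h b' (by simpa using hb')⟩
  choose f hf1 hf2 using hbest
  -- Otherwise the threshold of `f a` could be lowered to the rank of `a`, against minimality.
  have hft : ∀ a, r (f a) a = t (f a) := by
    intro a
    by_contra hne
    have hlt : r (f a) a < t (f a) := lt_of_le_of_ne (hf1 a) hne
    let t' := update t (f a) (r (f a) a)
    have hle : ∀ b, t' b ≤ t b := by
      intro b
      by_cases h : b = f a
      · subst h; simpa [t'] using hlt.le
      · simp [t', h]
    have hInv : Inv t' := by
      intro b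
      by_cases h : b = f a
      · subst h
        exact Or.inr ⟨a, by simp [t'], fun b' hb' => hf2 a b' (hb'.trans (hle b'))⟩
      · have hb : t' b = t b := by simp [t', h]
        rw [hb]
        exact (ht b).imp id fun ⟨c, h1, h2⟩ => ⟨c, h1, fun b' hb' => h2 b' (hb'.trans (hle b'))⟩
    have h1 := hmin t' hInv
    have h2 : ∑ b, t' b < ∑ b, t b :=
      Finset.sum_lt_sum (fun b _ => hle b) ⟨f a, Finset.mem_univ _, by simpa [t'] using hlt⟩
    omega
  have hinj : Injective f := by
    intro a a' h
    have e1 := hft a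
    have e2 := hft a'
    rw [← h] at e2
    exact hr _ (e1.trans e2.symm)
  refine ⟨Equiv.ofBijective f (Finite.injective_iff_bijective.mp hinj), ?_⟩
  intro a b hab
  obtain ⟨c, rfl⟩ := (Finite.injective_iff_surjective.mp hinj) b
  have e : (Equiv.ofBijective f (Finite.injective_iff_bijective.mp hinj)).symm (f c) = c := by
    rw [Equiv.symm_apply_eq]; rfl
  rw [e, hft]
  by_contra hc
  exact absurd (hf2 a (f c) (by omega)) (by simpa using hab)

/-- On a finite set every orbit eventually becomes periodic, and the hypothesis carries periodicity
backwards along it. -/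
theorem mem_periodicPts_of_preimage [Finite A] {g : A → A}
    (h : ∀ x, g x ∈ periodicPts g → x ∈ periodicPts g) (x : A) : x ∈ periodicPts g := by
  have hback : ∀ k x, g^[k] x ∈ periodicPts g → x ∈ periodicPts g := by
    intro k
    induction k with
    | zero => exact fun x hx => hx
    | succ k ih => exact fun x hx => h x (ih (g x) hx)
  have key : ∀ m n, m < n → g^[m] x = g^[n] x → x ∈ periodicPts g := by
    intro m n hlt e
    refine hback m x ⟨n - m, by omega, ?_⟩
    rw [IsPeriodicPt, IsFixedPt, ← iterate_add_apply, Nat.sub_add_cancel hlt.le, e]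
  obtain ⟨m, n, hne, e⟩ := Finite.exists_ne_map_eq_of_infinite fun n => g^[n] x
  rcases hne.lt_or_gt with hlt | hlt
  · exact key m n hlt e
  · exact key n m hlt e.symm

/-- Existence of stable partitions, in terms of ranks: among the stable matchings `P` of the
bipartite double cover with `P a` at least as good as `P⁻¹ a` for all `a`, one with the worst
successors is a stable partition, because otherwise rotations could be eliminated. -/
theorem exists_rankStable [Finite A] (hr : ∀ a, Injective (r a)) :
    ∃ P : Equiv.Perm A, RankStable r P := by
  classical
  have := Fintype.ofFinite A
  let W : Equiv.Perm A → Prop := fun P => BiStable r P ∧ ∀ a, r a (P a) ≤ r a (P.symm a)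
  have join_symm : ∀ N : Equiv.Perm A, BiStable r N → ∃ R, W R ∧
      ∀ a, r a (R a) = min (r a (N a)) (r a (N.symm a)) := by
    intro N hN
    obtain ⟨R, hR, h1, h2⟩ := hN.exists_join hr hN.symm
    exact ⟨R, ⟨hR, fun a => by rw [h1, h2]; simp⟩, h1⟩
  obtain ⟨P, hW, hmax⟩ : ∃ P, W P ∧ ∀ R, W R → (∀ a, r a (P a) ≤ r a (R a)) → R = P := by
    obtain ⟨N, hN⟩ := exists_biStable hr
    obtain ⟨R, hR, -⟩ := join_symm N hN
    obtain ⟨P, hP, h⟩ := (Finset.univ.filter W).exists_max_image (fun P => ∑ a, r a (P a))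
      ⟨R, by simpa using hR⟩
    refine ⟨P, by simpa using hP, fun R hR hle => Equiv.ext fun a => ?_⟩
    have h1 := h R (by simpa using hR)
    have h2 : ∑ a, r a (P a) ≤ ∑ a, r a (R a) := Finset.sum_le_sum fun a _ => hle a
    have h3 := (Finset.sum_eq_sum_iff_of_le fun a _ => hle a).mp (le_antisymm h2 h1)
    exact (hr a (h3 a (Finset.mem_univ a))).symm
  obtain ⟨hP, hPle⟩ := hW
  -- The reduced preference table. In the list of `a`, the first entry is `P a` (`T1`) and the last
  -- is `P.symm a`.
  let T : A → A → Prop := fun a b => r a b ≤ r a (P.symm a) ∧ r b a ≤ r b (P.symm b)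
  have Tsymm : ∀ a b, T a b → T b a := fun a b h => ⟨h.2, h.1⟩
  have T1 : ∀ a b, T a b → r a (P a) ≤ r a b := by
    intro a b h
    by_contra hc
    have h1 := hP a b (by omega)
    have h2 : P.symm b = a := hr b (le_antisymm h1 h.2)
    rw [Equiv.symm_apply_eq] at h2
    rw [h2] at hc
    exact hc le_rfl
  have TP : ∀ a, T a (P a) := fun a => ⟨hPle a, by simp⟩
  have TPs : ∀ a, T a (P.symm a) := fun a => by simpa using Tsymm _ _ (TP (P.symm a))
  have T_short : ∀ a b, P a = P.symm a → T a b → b = P a := fun a b h hT =>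
    hr a (le_antisymm (h ▸ hT.1) (T1 a b hT))
  have hs : ∀ a, ∃ s, T a s ∧ (∀ b, T a b → b ≠ P a → r a s ≤ r a b) ∧
      (s = P a → P a = P.symm a) := by
    intro a
    by_cases h : P a = P.symm a
    · exact ⟨P a, TP a, fun b hb hne => absurd (T_short a b h hb) hne, fun _ => h⟩
    · obtain ⟨s, hs, hmin⟩ := (Finset.univ.filter fun b => T a b ∧ b ≠ P a).exists_min_image (r a)
        ⟨P.symm a, by simpa using ⟨TPs a, fun e => h e.symm⟩⟩
      simp only [Finset.mem_filter, Finset.mem_univ, true_and] at hs hmin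
      exact ⟨s, hs.1, fun b hb hne => hmin b ⟨hb, hne⟩, fun e => absurd e hs.2⟩
  choose s sT smin sP using hs
  -- With `s a` the second entry in the list of `a`, the nontrivial cycles of `g` are the rotations.
  -- Below, `f` moves the periodic points to their second entries and leaves the other agents with
  -- `P`.
  let g : A → A := fun a => P.symm (s a)
  have g_short : ∀ a, P a = P.symm a → a ∈ periodicPts g := by
    intro a h
    refine ⟨1, one_pos, ?_⟩
    change P.symm (s a) = a
    rw [Equiv.symm_apply_eq]
    exact T_short a _ h (sT a)
  let f : A → A := fun a => if a ∈ periodicPts g then s a else P a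
  have fpos : ∀ a, a ∈ periodicPts g → f a = s a := fun a h => if_pos h
  have fneg : ∀ a, a ∉ periodicPts g → f a = P a := fun a h => if_neg h
  have fT : ∀ a, T a (f a) := by
    intro a
    by_cases h : a ∈ periodicPts g
    · rw [fpos a h]; exact sT a
    · rw [fneg a h]; exact TP a
  have hbij := bijOn_periodicPts g
  have hfinj : Injective f := by
    have aux : ∀ a b, a ∈ periodicPts g → b ∉ periodicPts g → f a ≠ f b := by
      intro a b ha hb h
      rw [fpos a ha, fneg b hb] at h
      have h2 : g a = b := by change P.symm (s a) = b; rw [h, Equiv.symm_apply_apply]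
      exact hb (h2 ▸ hbij.mapsTo ha)
    intro a b h
    by_cases ha : a ∈ periodicPts g <;> by_cases hb : b ∈ periodicPts g
    · rw [fpos a ha, fpos b hb] at h
      exact hbij.injOn ha hb (congrArg P.symm h)
    · exact absurd h (aux a b ha hb)
    · exact absurd h.symm (aux b a hb ha)
    · rw [fneg a ha, fneg b hb] at h
      exact P.injective h
  let N : Equiv.Perm A := Equiv.ofBijective f (Finite.injective_iff_bijective.mp hfinj)
  have NT : ∀ a, T a (N a) := fT
  have NTs : ∀ a, T a (N.symm a) := fun a => by simpa using Tsymm _ _ (NT (N.symm a))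
  have hN : BiStable r N := by
    intro a b hab
    by_contra hc
    have hT : T a b := ⟨hab.le.trans (NT a).1, (not_le.mp hc).le.trans (NTs b).1⟩
    have hne : b ≠ P a := by
      rintro rfl
      have := (NTs (P a)).1
      rw [Equiv.symm_apply_apply] at this
      exact hc this
    change r a b < r a (f a) at hab
    by_cases ha : a ∈ periodicPts g
    · rw [fpos a ha] at hab
      have := smin a b hT hne
      omega
    · rw [fneg a ha] at hab
      have := T1 a b hT
      omega
  obtain ⟨R, hRW, hR⟩ := join_symm N hN
  have hRP : R = P := by
    refine hmax R hRW fun a => ?_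
    rw [hR]
    exact le_min (T1 _ _ (NT a)) (T1 _ _ (NTs a))
  subst hRP
  -- On `C` the elimination changes the successor, yet the join with the inverse restores it, so it
  -- must come from `N.symm`. Hence `C` is closed under `R`, and second entries there are
  -- predecessors.
  let C : Set A := {a | a ∈ periodicPts g ∧ R a ≠ R.symm a}
  have hC : ∀ a ∈ C, R a ∈ C ∧ s (R a) = a := by
    rintro a ⟨ha, hL⟩
    have h1 : N.symm a = R a := by
      have hlt : r a (R a) ≠ r a (N a) := by
        intro e
        have := hr a e
        change R a = f a at this
        rw [fpos a ha] at this
        exact hL (sP a this.symm)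
      have := hR a
      exact hr a (by omega)
    have h2 : f (R a) = a := ((Equiv.symm_apply_eq N).mp h1).symm
    have h3 : R (R a) ≠ a := fun h => hL ((Equiv.symm_apply_eq R).mpr h.symm).symm
    have h4 : R a ∈ periodicPts g := by
      by_contra hc
      rw [fneg _ hc] at h2
      exact h3 h2
    rw [fpos _ h4] at h2
    exact ⟨⟨h4, by rwa [Equiv.symm_apply_apply]⟩, h2⟩
  have hCs : ∀ a ∈ C, R.symm a ∈ C := fun a ha =>
    Equiv.Perm.perm_symm_mapsTo_of_mapsTo R (fun a ha => (hC a ha).1) ha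
  -- The second entry in the list is also the last one.
  have hCT : ∀ a ∈ C, ∀ b, T a b → b = R a ∨ b = R.symm a := by
    intro a ha b hT
    by_cases h : b = R a
    · exact Or.inl h
    · right
      have h1 := smin a b hT h
      have h2 := (hC _ (hCs a ha)).2
      rw [Equiv.apply_symm_apply] at h2
      rw [h2] at h1
      exact hr a (le_antisymm hT.1 h1)
  have hall : ∀ x, x ∈ periodicPts g := by
    refine mem_periodicPts_of_preimage fun x hx => ?_
    have hTx : T (R (g x)) x := by
      have : R (g x) = s x := R.apply_symm_apply _
      rw [this]
      exact Tsymm _ _ (sT x)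
    by_cases hL : R (g x) = R.symm (g x)
    · have hz : R (R (g x)) = g x := by rw [hL, Equiv.apply_symm_apply]
      have := T_short _ x (by rw [hz, Equiv.symm_apply_apply]) hTx
      rw [this, hz]
      exact hx
    · have h1 := (hC _ ⟨hx, hL⟩).1
      rcases hCT _ h1 x hTx with h | h
      · rw [h]; exact (hC _ h1).1.1
      · rw [h]; exact (hCs _ h1).1
  refine ⟨R, hPle, fun i j hij => ?_⟩
  by_contra hc
  have hT : T i j := ⟨hij.le, (not_le.mp hc).le⟩
  have hj : j = R i := by
    by_cases hL : R i = R.symm i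
    · exact T_short i j hL hT
    · refine (hCT i ⟨hall i, hL⟩ j hT).resolve_right ?_
      rintro rfl
      exact lt_irrefl _ hij
  subst hj
  simp at hc

end Rank

/-! ### Odd cycles are common to all stable partitions. -/

section Rank

variable {A : Type*} {r : A → A → ℕ}

theorem apply_apply_ne_of_odd_minimalPeriod {g : A → A} {a : A}
    (hodd : Odd (minimalPeriod g a)) (hne : g a ≠ a) : g (g a) ≠ a := by
  intro h
  have hdvd : minimalPeriod g a ∣ 2 := IsPeriodicPt.minimalPeriod_dvd h
  rcases (Nat.dvd_prime Nat.prime_two).mp hdvd with h1 | h1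
  · exact hne (minimalPeriod_eq_one_iff_isFixedPt.mp h1)
  · rw [h1] at hodd
    exact absurd hodd (by decide)

/-- On an odd cycle of a stable partition `P`, a stable matching of the bipartite double cover is
either everywhere at least as good as `P`, or everywhere at most as good as `P⁻¹`. -/
theorem RankStable.dichotomy [Finite A] (hr : ∀ a, Injective (r a)) {P M : Equiv.Perm A}
    (hP : RankStable r P) (hM : BiStable r M) {a : A} (hodd : Odd (minimalPeriod P a))
    (hne : P a ≠ a) :
    (∀ k, r (P^[k] a) (M (P^[k] a)) ≤ r (P^[k] a) (P (P^[k] a))) ∨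
      ∀ k, r (P^[k] a) (P.symm (P^[k] a)) ≤ r (P^[k] a) (M (P^[k] a)) := by
  -- Inverting a join gives the worse of `P x` and `M x`; the join of this with `P.symm` makes `N x`
  -- the median of `P x`, `M x` and `P.symm x`.
  obtain ⟨H, hH, hH1, hH2⟩ := hP.biStable.symm.exists_join hr hM.symm
  obtain ⟨N, -, hN1, hN2⟩ := hH.symm.exists_join hr hP.biStable.symm
  simp only [Equiv.symm_symm] at hH1 hH2 hN1 hN2
  have hper : ∀ k, minimalPeriod P (P^[k] a) = minimalPeriod P a :=
    minimalPeriod_apply_iterate (P.injective.mem_periodicPts a)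
  have hne2 : ∀ k, P (P (P^[k] a)) ≠ P^[k] a := by
    intro k
    refine apply_apply_ne_of_odd_minimalPeriod ((hper k).symm ▸ hodd) fun h => hne ?_
    rw [← iterate_succ_apply' P k a, iterate_succ_apply] at h
    exact P.injective.iterate k h
  have hcase : ∀ x, N x = P x ∨ N x = P.symm x := by
    intro x
    by_contra! hc
    have h1 : r x (N x) < r x (P.symm x) := by
      refine lt_of_le_of_ne ?_ fun e => hc.2 (hr x e)
      rw [hN1]; exact min_le_right _ _
    have h2 := hP.2 x (N x) h1
    have h3 : r (N x) x ≤ r (N x) (P.symm (N x)) := by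
      have e1 := hN2 (N x)
      have e2 := hH1 (N x)
      have e3 := hP.1 (N x)
      rw [Equiv.symm_apply_apply] at e1
      omega
    have h4 := hr _ (le_antisymm h2 h3)
    exact hc.1 ((Equiv.symm_apply_eq P).mp h4)
  -- Choosing the predecessor two steps later would give `N` the same value at two different agents.
  have hstep2 : ∀ k, N (P^[k] a) = P (P^[k] a) → N (P^[k + 2] a) = P (P^[k + 2] a) := by
    intro k h
    refine (hcase _).resolve_right fun h' => hne2 k ?_
    have e : P^[k + 2] a = P (P (P^[k] a)) := by
      rw [iterate_succ_apply', iterate_succ_apply']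
    rw [e, Equiv.symm_apply_apply] at h'
    exact N.injective (h'.trans h.symm)
  have hstep : ∀ k j, N (P^[k] a) = P (P^[k] a) → N (P^[k + 2 * j] a) = P (P^[k + 2 * j] a) := by
    intro k j h
    induction j with
    | zero => exact h
    | succ j ih => exact hstep2 _ ih
  have hprop : ∀ k l, N (P^[k] a) = P (P^[k] a) → N (P^[l] a) = P (P^[l] a) := by
    intro k l h
    obtain ⟨m, hm⟩ := hodd
    -- As the period is odd, the parity of `q` can be set to that of `k - l`; `q ≥ k` keeps the
    -- subtraction defining `j` from truncating.
    obtain ⟨q, j, hj⟩ : ∃ q j, k + 2 * j = l + minimalPeriod P a * q := by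
      by_cases hkl : k % 2 = l % 2
      · exact ⟨2 * k, (l + minimalPeriod P a * (2 * k) - k) / 2, by
          rw [hm]; have : (2 * m + 1) * (2 * k) = 2 * (2 * m * k + k) := by ring
          rw [this]; have := Nat.zero_le (2 * m * k); omega⟩
      · exact ⟨2 * k + 1, (l + minimalPeriod P a * (2 * k + 1) - k) / 2, by
          rw [hm]
          have : (2 * m + 1) * (2 * k + 1) = 2 * (2 * m * k + m + k) + 1 := by ring
          rw [this]; have := Nat.zero_le (2 * m * k); omega⟩
    have h2 := hstep k j h
    have e : P^[l + minimalPeriod P a * q] a = P^[l] a := by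
      rw [iterate_add_apply, ((isPeriodicPt_minimalPeriod P a).mul_const q).eq]
    rwa [hj, e] at h2
  have hlt : ∀ k, r (P^[k] a) (P (P^[k] a)) < r (P^[k] a) (P.symm (P^[k] a)) := by
    intro k
    refine lt_of_le_of_ne (hP.1 _) fun e => hne2 k ?_
    exact ((Equiv.symm_apply_eq P).mp (hr _ e).symm).symm
  by_cases h : N a = P a
  · left
    intro k
    have h1 := hprop 0 k h
    have h2 := hN1 (P^[k] a)
    have h3 := hH2 (P^[k] a)
    have h4 := hlt k
    rw [h1] at h2
    omega
  · right
    intro k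
    have h1 : N (P^[k] a) = P.symm (P^[k] a) :=
      (hcase _).resolve_left fun h' => h (hprop k 0 h')
    have h2 := hN1 (P^[k] a)
    have h3 := hH2 (P^[k] a)
    have h4 := hlt k
    rw [h1] at h2
    omega

/-- Two stable partitions agree on the odd cycles of either. -/
theorem RankStable.apply_eq_of_odd [Finite A] (hr : ∀ a, Injective (r a))
    (hself : ∀ a b, r a b ≤ r a a) {P Q : Equiv.Perm A} (hP : RankStable r P)
    (hQ : RankStable r Q) {a : A} (hodd : Odd (minimalPeriod P a)) : Q a = P a := by
  -- Stability of `P`, then of `Q`, shows that `G` is preserved by `Q⁻¹` followed by `P⁻¹`. By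
  -- finiteness it is preserved by the inverse map too, which prevents `a` and `P a` from both lying
  -- in `G`.
  let G : Set A := {a | r a (Q.symm a) < r a (P a)}
  have hGB : ∀ a ∈ G, r (Q.symm a) (P.symm (Q.symm a)) < r (Q.symm a) a := by
    intro a ha
    refine lt_of_le_of_ne (hP.2 a _ (lt_of_lt_of_le ha (hP.1 a))) fun e => ?_
    have h1 := (Equiv.symm_apply_eq P).mp (hr _ e)
    exact absurd ha (by simp [G, h1])
  have hBG : ∀ b, r b (P.symm b) < r b (Q b) → P.symm b ∈ G := by
    intro b hb
    have h1 := hQ.2 b (P.symm b) (lt_of_lt_of_le hb (hQ.1 b))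
    change r _ _ < r _ _
    rw [Equiv.apply_symm_apply]
    refine lt_of_le_of_ne h1 fun e => ?_
    have h2 := (Equiv.symm_apply_eq Q).mp (hr _ e)
    rw [h2] at hb
    exact lt_irrefl _ hb
  have hmaps : Set.MapsTo (Q.symm.trans P.symm) G G := by
    intro a ha
    refine hBG _ ?_
    rw [Equiv.apply_symm_apply]
    exact hGB a ha
  have hG : ∀ a ∈ G, P a ∉ G := by
    intro a ha h
    have h1 : Q (P a) ∈ G := Equiv.Perm.perm_symm_mapsTo_of_mapsTo _ hmaps ha
    have h2 := hGB _ h1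
    rw [Equiv.symm_apply_apply] at h2
    have h3 := hQ.1 (P a)
    have h4 := hP.1 (P a)
    change r (P a) _ < r (P a) _ at h
    omega
  by_cases hfix : P a = a
  · by_contra hne
    have ha : a ∈ G := by
      change r _ _ < r _ _
      rw [hfix]
      refine lt_of_le_of_ne (hself _ _) fun e => hne ?_
      rw [hfix]
      exact ((Equiv.symm_apply_eq Q).mp (hr a e)).symm
    exact hG a ha (hfix.symm ▸ ha)
  -- The first alternative puts the whole cycle into `G`. In the second, `a` prefers `P a` to its
  -- `Q`-predecessor, and stability of `Q` makes `a` the `Q`-predecessor of `P a`.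
  · rcases hP.dichotomy hr hQ.biStable.symm hodd hfix with h | h
    · exfalso
      have hper := minimalPeriod_apply_iterate (P.injective.mem_periodicPts a)
      have key : ∀ k, P^[k] a ∈ G := by
        intro k
        refine lt_of_le_of_ne (h k) fun e => ?_
        have e1 := hr _ e
        have h2 := h (k + 1)
        rw [iterate_succ_apply'] at h2
        set x := P^[k] a
        have e2 : Q (P x) = x := ((Equiv.symm_apply_eq Q).mp e1).symm
        have h3 := hQ.1 (P x)
        have h4 := hP.1 (P x)
        rw [e2] at h3
        rw [Equiv.symm_apply_apply] at h4
        have h5 : P (P x) = x := hr (P x) (by omega)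
        refine apply_apply_ne_of_odd_minimalPeriod ((hper k).symm ▸ hodd) (fun h => hfix ?_) h5
        change P (P^[k] a) = P^[k] a at h
        rw [← iterate_succ_apply' P k a, iterate_succ_apply] at h
        exact P.injective.iterate k h
      exact hG a (key 0) (key 1)
    · have h0 := h 0
      have h1 := h 1
      simp only [iterate_zero_apply, iterate_one, Equiv.symm_apply_apply] at h0 h1
      have hlt : r a (P a) < r a (P.symm a) := by
        refine lt_of_le_of_ne (hP.1 _) fun e => ?_
        exact apply_apply_ne_of_odd_minimalPeriod hodd hfix
          ((Equiv.symm_apply_eq P).mp (hr _ e).symm).symm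
      have h2 := hQ.2 a (P a) (hlt.trans_le h0)
      exact ((Equiv.symm_apply_eq Q).mp (hr _ (le_antisymm h2 h1))).symm

end Rank

/-! ### Transfer from ranks to instances. -/

section Instance

variable {A : Type*} (I : SRInstance A)

theorem StrictlyPrefers.ne {i j k : A} (h : I.StrictlyPrefers i j k) : j ≠ k := by
  rintro rfl
  rcases h with h | ⟨h1, h2⟩
  · exact I.irrefl _ _ h
  · exact h1 h2

theorem StrictlyPrefers.trans {i j k l : A} (h : I.StrictlyPrefers i j k)
    (h' : I.StrictlyPrefers i k l) : I.StrictlyPrefers i j l := by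
  rcases h with h | ⟨h1, h2⟩ <;> rcases h' with h' | ⟨h3, h4⟩
  · exact Or.inl (I.trans _ _ _ _ h h')
  · exact Or.inr ⟨(I.ne_of_prefers _ _ _ h).1, h4⟩
  · exact absurd h2 (I.ne_of_prefers _ _ _ h').1
  · exact absurd h2 h3

theorem strictlyPrefers_total (i : A) {j k : A} (h : j ≠ k) :
    I.StrictlyPrefers i j k ∨ I.StrictlyPrefers i k j := by
  by_cases hj : j = i
  · exact Or.inr (Or.inr ⟨fun hk => h (hj.trans hk.symm), hj⟩)
  · by_cases hk : k = i
    · exact Or.inl (Or.inr ⟨hj, hk⟩)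
    · exact (I.total i j k hj hk h).imp Or.inl Or.inl

theorem exists_rank [Finite A] : ∃ r : A → A → ℕ, (∀ a, Injective (r a)) ∧
    (∀ a b, r a b ≤ r a a) ∧ ∀ a j k, I.StrictlyPrefers a j k ↔ r a j < r a k := by
  -- The rank of `k` is the number of agents that `a` places above it.
  let r : A → A → ℕ := fun a k => {j | I.StrictlyPrefers a j k}.ncard
  have hlt : ∀ a j k, I.StrictlyPrefers a j k → r a j < r a k := by
    intro a j k h
    refine Set.ncard_lt_ncard ⟨fun x hx => StrictlyPrefers.trans I hx h, fun hs => ?_⟩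
      (Set.toFinite _)
    exact StrictlyPrefers.ne I (hs h) rfl
  have hinj : ∀ a, Injective (r a) := by
    intro a j k h
    by_contra hne
    rcases I.strictlyPrefers_total a hne with h' | h' <;> have := hlt _ _ _ h' <;> omega
  refine ⟨r, hinj, fun a b => ?_, fun a j k => ⟨hlt a j k, fun h => ?_⟩⟩
  · by_cases h : b = a
    · rw [h]
    · exact (hlt a b a (Or.inr ⟨h, rfl⟩)).le
  · refine (I.strictlyPrefers_total a (j := j) (k := k) ?_).resolve_right fun h' => ?_
    · rintro rfl; exact lt_irrefl _ h
    · have := hlt _ _ _ h'; omega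

theorem isStablePartition_iff_rankStable {r : A → A → ℕ} (hr : ∀ a, Injective (r a))
    (hself : ∀ a b, r a b ≤ r a a) (hI : ∀ a j k, I.StrictlyPrefers a j k ↔ r a j < r a k)
    (P : Equiv.Perm A) : I.IsStablePartition P ↔ RankStable r P := by
  simp only [IsStablePartition, RankStable, hI]
  refine and_congr (forall_congr' fun i => ?_) ⟨fun h i j hij => ?_, fun h => ?_⟩
  · rw [le_iff_eq_or_lt, (hr i).eq_iff]
  · by_contra hc
    refine h ⟨i, j, ?_, hij, not_le.mp hc⟩
    rintro rfl
    exact absurd (hself i (P.symm i)) (not_le.mpr hij)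
  · rintro ⟨i, j, -, h1, h2⟩
    exact absurd (h i j h1) (not_le.mpr h2)

theorem exists_isStablePartition [Finite A] : ∃ P : Equiv.Perm A, I.IsStablePartition P := by
  obtain ⟨r, hr, hself, hI⟩ := I.exists_rank
  obtain ⟨P, hP⟩ := exists_rankStable hr
  exact ⟨P, (I.isStablePartition_iff_rankStable hr hself hI P).mpr hP⟩

variable {I} {P Q : Equiv.Perm A}

theorem IsStablePartition.apply_eq_of_odd [Finite A] (hP : I.IsStablePartition P)
    (hQ : I.IsStablePartition Q) {a : A} (hodd : Odd (minimalPeriod P a)) : Q a = P a := by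
  obtain ⟨r, hr, hself, hI⟩ := I.exists_rank
  rw [I.isStablePartition_iff_rankStable hr hself hI] at hP hQ
  exact hP.apply_eq_of_odd hr hself hQ hodd

theorem IsStablePartition.iterate_eq_of_odd [Finite A] (hP : I.IsStablePartition P)
    (hQ : I.IsStablePartition Q) {a : A} (hodd : Odd (minimalPeriod P a)) (k : ℕ) :
    Q^[k] a = P^[k] a := by
  induction k with
  | zero => rfl
  | succ k ih =>
    rw [iterate_succ_apply', iterate_succ_apply', ih]
    refine hP.apply_eq_of_odd hQ ?_
    rwa [minimalPeriod_apply_iterate (P.injective.mem_periodicPts a)]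

theorem IsStablePartition.oddCyclesOf_subset [Finite A] (hP : I.IsStablePartition P)
    (hQ : I.IsStablePartition Q) : oddCyclesOf P ⊆ oddCyclesOf Q := by
  rintro _ ⟨⟨a, rfl⟩, hodd⟩
  refine ⟨⟨a, ?_⟩, hodd⟩
  rw [periodicOrbit_length] at hodd
  have h := hP.iterate_eq_of_odd hQ hodd
  have hmin : minimalPeriod P a = minimalPeriod Q a := by
    refine minimalPeriod_eq_minimalPeriod_iff.mpr fun n => ?_
    rw [IsPeriodicPt, IsPeriodicPt, IsFixedPt, IsFixedPt, h]
  rw [periodicOrbit_def, periodicOrbit_def, hmin]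
  congr 2
  funext k
  exact (h k).symm

theorem IsStablePartition.oddCyclesOf_eq [Finite A] (hP : I.IsStablePartition P) :
    oddCyclesOf P = I.oddCycles := by
  ext c
  exact ⟨fun hc Q hQ => hP.oddCyclesOf_subset hQ hc, fun hc => hc P hP⟩

end Instance

/-! ### Counting and colouring the cycles of a permutation. -/

section Counting

variable {A : Type*} (P : Equiv.Perm A)

theorem periodicOrbit_eq_iff_exists_iterate [Finite A] {a b : A} :
    periodicOrbit P b = periodicOrbit P a ↔ ∃ k, P^[k] a = b := by
  have ha := P.injective.mem_periodicPts a
  refine ⟨fun h => ?_, ?_⟩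
  · have hb := self_mem_periodicOrbit (P.injective.mem_periodicPts b)
    rw [h] at hb
    exact (mem_periodicOrbit_iff ha).mp hb
  · rintro ⟨k, rfl⟩
    exact periodicOrbit_apply_iterate_eq ha k

open Classical in
theorem sum_length_periodicOrbit [Fintype A] :
    ∑ c ∈ Finset.univ.image (periodicOrbit P), c.length = Fintype.card A := by
  rw [← Finset.card_univ, Finset.card_eq_sum_card_image (periodicOrbit P) Finset.univ]
  refine Finset.sum_congr rfl fun c hc => ?_
  obtain ⟨a, -, rfl⟩ := Finset.mem_image.mp hc
  have ha := P.injective.mem_periodicPts a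
  have hset : Finset.univ.filter (fun b => periodicOrbit P b = periodicOrbit P a) =
      (Finset.range (minimalPeriod P a)).image (fun k => P^[k] a) := by
    ext b
    simp only [Finset.mem_filter, Finset.mem_univ, true_and, Finset.mem_image, Finset.mem_range,
      periodicOrbit_eq_iff_exists_iterate]
    refine ⟨fun ⟨k, hk⟩ => ⟨k % minimalPeriod P a,
      Nat.mod_lt _ (minimalPeriod_pos_of_mem_periodicPts ha), ?_⟩, fun ⟨k, _, hk⟩ => ⟨k, hk⟩⟩
    rw [iterate_mod_minimalPeriod_eq, hk]
  rw [hset, Finset.card_image_of_injOn, Finset.card_range, periodicOrbit_length]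
  simpa [Finset.coe_range] using iterate_injOn_Iio_minimalPeriod (f := P) (x := a)

open Classical in
theorem oddCyclesOf_eq_coe_filter [Fintype A] : oddCyclesOf P =
    ((Finset.univ.image (periodicOrbit P)).filter fun c => Odd c.length : Finset (Cycle A)) := by
  ext c
  simp [oddCyclesOf, eq_comm]

theorem odd_ncard_oddCyclesOf_iff [Fintype A] :
    Odd (oddCyclesOf P).ncard ↔ Odd (Fintype.card A) := by
  classical
  rw [oddCyclesOf_eq_coe_filter, Set.ncard_coe_finset, ← sum_length_periodicOrbit P,
    Finset.odd_sum_iff_odd_card_odd]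

theorem card_length_one_le (hfix : ∀ a b, P a = a → P b = b → a = b) {F : Finset (Cycle A)}
    (hF : ∀ c ∈ F, c.length = 1 ∧ ∃ a, c = periodicOrbit P a) : F.card ≤ 1 := by
  refine Finset.card_le_one.mpr fun c hc d hd => ?_
  obtain ⟨h1, a, rfl⟩ := hF c hc
  obtain ⟨h2, b, rfl⟩ := hF d hd
  rw [periodicOrbit_length, minimalPeriod_eq_one_iff_isFixedPt] at h1 h2
  rw [hfix a b h1 h2]

/-- Odd cycles have length at least three except for at most one fixed point, whose deficit is two.
-/
theorem three_mul_ncard_oddCyclesOf_le [Fintype A]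
    (hfix : ∀ a b, P a = a → P b = b → a = b) :
    3 * (oddCyclesOf P).ncard ≤ Fintype.card A + 2 := by
  classical
  rw [oddCyclesOf_eq_coe_filter, Set.ncard_coe_finset, ← sum_length_periodicOrbit P]
  set S := Finset.univ.image (periodicOrbit P)
  set F := S.filter fun c => Odd c.length
  have h1 : ∑ c ∈ F, c.length ≤ ∑ c ∈ S, c.length :=
    Finset.sum_le_sum_of_subset (Finset.filter_subset _ _)
  have h2 : (F.filter fun c => c.length = 1).card ≤ 1 := by
    refine card_length_one_le P hfix fun c hc => ?_
    simp only [F, S, Finset.mem_filter, Finset.mem_image, Finset.mem_univ, true_and] at hc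
    exact ⟨hc.2, hc.1.1.imp fun a h => h.symm⟩
  have h3 : F.card * 3 ≤ ∑ c ∈ F, (c.length + if c.length = 1 then 2 else 0) := by
    rw [← smul_eq_mul]
    refine Finset.card_nsmul_le_sum _ _ _ fun c hc => ?_
    obtain ⟨k, hk⟩ := (Finset.mem_filter.mp hc).2
    split_ifs <;> omega
  rw [Finset.sum_add_distrib, ← Finset.sum_filter, Finset.sum_const, smul_eq_mul] at h3
  omega

/-- The even cycles of a permutation can be coloured alternately. -/
theorem exists_alternating_colouring [Finite A] : ∃ f : A → ℕ, ∀ x,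
    Even (minimalPeriod P x) → (Even (f (P x)) ↔ ¬ Even (f x)) := by
  classical
  let rep : Cycle A → A → A := fun c x =>
    if h : ∃ y, periodicOrbit P y = c then h.choose else x
  have hrep : ∀ x, periodicOrbit P (rep (periodicOrbit P x) x) = periodicOrbit P x := by
    intro x
    have h : ∃ y, periodicOrbit P y = periodicOrbit P x := ⟨x, rfl⟩
    simp only [rep, dif_pos h]
    exact h.choose_spec
  have hrep' : ∀ x, rep (periodicOrbit P (P x)) (P x) = rep (periodicOrbit P x) x := by
    intro x
    have h : ∃ y, periodicOrbit P y = periodicOrbit P x := ⟨x, rfl⟩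
    rw [periodicOrbit_apply_eq (P.injective.mem_periodicPts x)]
    simp only [rep, dif_pos h]
  have hex : ∀ x, ∃ k, P^[k] (rep (periodicOrbit P x) x) = x := fun x =>
    (periodicOrbit_eq_iff_exists_iterate P).mp (hrep x).symm
  choose f hf using hex
  refine ⟨f, fun x hx => ?_⟩
  have h1 := hf (P x)
  rw [hrep'] at h1
  set y := rep (periodicOrbit P x) x
  have hlen : minimalPeriod P y = minimalPeriod P x := by
    rw [← periodicOrbit_length, ← periodicOrbit_length, hrep]
  have h2 : P^[f x + 1] y = P x := by rw [iterate_succ_apply', hf]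
  have hpos := minimalPeriod_pos_of_mem_periodicPts (P.injective.mem_periodicPts y)
  have h3 : f (P x) % minimalPeriod P y = (f x + 1) % minimalPeriod P y := by
    rw [← iterate_eq_iterate_iff_of_lt_minimalPeriod (Nat.mod_lt _ hpos) (Nat.mod_lt _ hpos),
      iterate_mod_minimalPeriod_eq, iterate_mod_minimalPeriod_eq, h1, h2]
  have hdvd : 2 ∣ minimalPeriod P y := by rw [hlen]; exact hx.two_dvd
  have h4 : f (P x) % 2 = (f x + 1) % 2 := by
    rw [← Nat.mod_mod_of_dvd _ hdvd, h3, Nat.mod_mod_of_dvd _ hdvd]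
  rw [Nat.even_iff, Nat.even_iff]
  omega

end Counting

/-! ### Solvability in terms of odd cycles, and the bounds. -/

section Solvability

variable {A : Type*} {I : SRInstance A} {P : Equiv.Perm A}

theorem IsStablePartition.eq_of_fixed (hP : I.IsStablePartition P) (a b : A) (ha : P a = a)
    (hb : P b = b) : a = b := by
  by_contra hne
  refine hP.2 ⟨a, b, hne, Or.inr ⟨Ne.symm hne, ?_⟩, Or.inr ⟨hne, ?_⟩⟩
  · exact (Equiv.symm_apply_eq P).mpr ha.symm
  · exact (Equiv.symm_apply_eq P).mpr hb.symm

theorem solvable_of_involutive {N : A → A} (hN : Involutive N)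
    (hstable : ∀ i j, i ≠ j → I.StrictlyPrefers i j (N i) → ¬ I.StrictlyPrefers j i (N j)) :
    I.Solvable := by
  let M : Set (Sym2 A) := {e | ∃ x, N x ≠ x ∧ e = s(x, N x)}
  have hM : ∀ e ∈ M, ∀ a ∈ e, e = s(a, N a) := by
    rintro _ ⟨x, -, rfl⟩ a ha
    rcases Sym2.mem_iff.mp ha with rfl | rfl
    · rfl
    · rw [hN x, Sym2.eq_swap]
  have hswitch : ∀ i j, i ≠ j → I.WouldSwitch M i j → I.StrictlyPrefers i j (N i) := by
    rintro i j hij (h | ⟨k, hk, h⟩)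
    · refine Or.inr ⟨hij.symm, ?_⟩
      by_contra hc
      exact h _ ⟨i, hc, rfl⟩
    · have := hM _ hk i (Sym2.mem_mk_left i k)
      rw [Sym2.congr_right] at this
      exact Or.inl (this ▸ h)
  refine ⟨M, ⟨?_, fun a e he f hf hae haf => (hM e he a hae).trans (hM f hf a haf).symm⟩, ?_⟩
  · rintro _ ⟨x, hx, rfl⟩ h
    exact hx (Sym2.mk_isDiag_iff.mp h).symm
  · rintro i j ⟨hij, h1, h2⟩
    exact hstable i j hij (hswitch i j hij h1) (hswitch j i hij.symm h2)

theorem Solvable.exists_involutive (h : I.Solvable) : ∃ P : Equiv.Perm A,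
    I.IsStablePartition P ∧ ∀ a, P (P a) = a := by
  classical
  obtain ⟨M, ⟨hdiag, huniq⟩, hblock⟩ := h
  let N : A → A := fun i => if h : ∃ k, s(i, k) ∈ M then h.choose else i
  have hN : ∀ i k, s(i, k) ∈ M → N i = k := by
    intro i k hk
    have h : ∃ k, s(i, k) ∈ M := ⟨k, hk⟩
    have h1 : N i = h.choose := dif_pos h
    have h2 := huniq i _ h.choose_spec _ hk (Sym2.mem_mk_left _ _) (Sym2.mem_mk_left _ _)
    rw [h1]
    exact Sym2.congr_right.mp h2
  have hcase : ∀ i, s(i, N i) ∈ M ∨ (N i = i ∧ ∀ k, s(i, k) ∉ M) := by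
    intro i
    by_cases h : ∃ k, s(i, k) ∈ M
    · obtain ⟨k, hk⟩ := h
      rw [hN i k hk]
      exact Or.inl hk
    · exact Or.inr ⟨dif_neg h, not_exists.mp h⟩
  have hinv : Involutive N := by
    intro i
    rcases hcase i with h | ⟨h, -⟩
    · exact hN _ _ (Sym2.eq_swap ▸ h)
    · rw [h, h]
  have hswitch : ∀ i j, I.StrictlyPrefers i j (N i) → I.WouldSwitch M i j := by
    rintro i j (h | ⟨-, h2⟩)
    · rcases hcase i with h' | ⟨h', -⟩
      · exact Or.inr ⟨_, h', h⟩
      · exact absurd h' (I.ne_of_prefers _ _ _ h).2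
    · rcases hcase i with h' | ⟨-, h'⟩
      · rw [h2] at h'
        exact absurd (Sym2.mk_isDiag_iff.mpr rfl) (hdiag _ h')
      · exact Or.inl h'
  refine ⟨hinv.toPerm, ⟨fun i => Or.inl rfl, ?_⟩, hinv⟩
  rintro ⟨i, j, hij, h1, h2⟩
  exact hblock i j ⟨hij, hswitch i j h1, hswitch j i h2⟩

/-- An instance is solvable iff a stable partition has no odd cycles but fixed points. -/
theorem IsStablePartition.solvable_iff [Finite A] (hP : I.IsStablePartition P) :
    I.Solvable ↔ ∀ a, Odd (minimalPeriod P a) → P a = a := by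
  classical
  refine ⟨fun h a hodd => ?_, fun h => ?_⟩
  · obtain ⟨Q, hQ, hinv⟩ := h.exists_involutive
    by_contra hne
    refine apply_apply_ne_of_odd_minimalPeriod hodd hne ?_
    have h2 := hP.iterate_eq_of_odd hQ hodd 2
    exact h2.symm.trans (hinv a)
  · obtain ⟨f, hf⟩ := exists_alternating_colouring P
    have hf' : ∀ x, P x ≠ x → (Even (f (P x)) ↔ ¬ Even (f x)) := fun x hx =>
      hf x (Nat.not_odd_iff_even.mp fun ho => hx (h x ho))
    -- The colouring splits each even cycle into adjacent pairs. Nobody does worse than its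
    -- predecessor, so a blocking pair of `N` would violate stability of `P`.
    let N : A → A := fun x => if P x = x then x else if Even (f x) then P x else P.symm x
    have hNcase : ∀ x, N x = P x ∨ N x = P.symm x := by
      intro x
      by_cases h1 : P x = x
      · simp [N, h1]
      · by_cases h2 : Even (f x) <;> simp [N, h1, h2]
    have hinv : Involutive N := by
      intro x
      by_cases h1 : P x = x
      · simp [N, h1]
      · by_cases h2 : Even (f x)
        · have h3 : ¬ Even (f (P x)) := fun h3 => (hf' x h1).mp h3 h2
          simp [N, h1, h2, h3]
        · have h4 : P (P.symm x) ≠ P.symm x := by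
            rw [Equiv.apply_symm_apply]
            exact fun h => h1 ((Equiv.eq_symm_apply P).mp h)
          have h3 : Even (f (P.symm x)) := by
            by_contra h3
            have := (hf' _ h4).mpr h3
            rw [Equiv.apply_symm_apply] at this
            exact h2 this
          have h5 : N x = P.symm x := by simp [N, h1, h2]
          rw [h5]
          simp only [N, if_neg h4, if_pos h3, Equiv.apply_symm_apply]
    have hle : ∀ i j, I.StrictlyPrefers i j (N i) → I.StrictlyPrefers i j (P.symm i) := by
      intro i j hij
      rcases hNcase i with h1 | h1 <;> rw [h1] at hij
      · rcases hP.1 i with h2 | h2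
        · rwa [h2] at hij
        · exact StrictlyPrefers.trans I hij h2
      · exact hij
    exact solvable_of_involutive hinv fun i j hij h1 h2 =>
      hP.2 ⟨i, j, hij, hle i j h1, hle j i h2⟩

theorem odd_ncard_oddCycles_iff [Fintype A] (I : SRInstance A) :
    Odd I.oddCycles.ncard ↔ Odd (Fintype.card A) := by
  obtain ⟨P, hP⟩ := I.exists_isStablePartition
  rw [← hP.oddCyclesOf_eq, odd_ncard_oddCyclesOf_iff]

/-- The length count alone allows `⌊(n + 2) / 3⌋`. For `n ≡ 2` modulo 3 this is one too many, and
parity excludes it. -/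
theorem ncard_oddCycles_le [Fintype A] (I : SRInstance A) :
    I.oddCycles.ncard ≤ Fintype.card A / 3 + Fintype.card A % 3 % 2 := by
  obtain ⟨P, hP⟩ := I.exists_isStablePartition
  have h1 := three_mul_ncard_oddCyclesOf_le P hP.eq_of_fixed
  have h2 := I.odd_ncard_oddCycles_iff
  rw [hP.oddCyclesOf_eq] at h1
  rw [Nat.odd_iff, Nat.odd_iff] at h2
  omega

theorem Solvable.ncard_oddCycles_le_one [Fintype A] (h : I.Solvable) :
    I.oddCycles.ncard ≤ 1 := by
  classical
  obtain ⟨P, hP⟩ := I.exists_isStablePartition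
  rw [← hP.oddCyclesOf_eq, oddCyclesOf_eq_coe_filter, Set.ncard_coe_finset]
  refine card_length_one_le P hP.eq_of_fixed fun c hc => ?_
  simp only [Finset.mem_filter, Finset.mem_image, Finset.mem_univ, true_and] at hc
  obtain ⟨⟨a, rfl⟩, hodd⟩ := hc
  rw [periodicOrbit_length] at hodd
  refine ⟨?_, a, rfl⟩
  rw [periodicOrbit_length, minimalPeriod_eq_one_iff_isFixedPt]
  exact hP.solvable_iff.mp h a hodd

theorem one_le_ncard_oddCycles [Fintype A] (h : ¬ I.Solvable) : 1 ≤ I.oddCycles.ncard := by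
  classical
  obtain ⟨P, hP⟩ := I.exists_isStablePartition
  rw [hP.solvable_iff] at h
  push Not at h
  obtain ⟨a, hodd, -⟩ := h
  rw [← hP.oddCyclesOf_eq, oddCyclesOf_eq_coe_filter, Set.ncard_coe_finset, Nat.one_le_iff_ne_zero]
  refine Finset.card_ne_zero_of_mem (a := periodicOrbit P a) ?_
  simpa using hodd

end Solvability

/-! ### Instances attaining the bounds. -/

section Construction

/-- Every permutation with at most one fixed point is a stable partition of some instance: let
each agent rank its successor first and its predecessor second. -/
theorem exists_instance_isStablePartition {A : Type*} [Finite A] (P : Equiv.Perm A)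
    (hfix : ∀ a b, P a = a → P b = b → a = b) : ∃ I : SRInstance A, I.IsStablePartition P := by
  classical
  obtain ⟨e, he⟩ : ∃ e : A → ℕ, Injective e := by
    obtain ⟨n, ⟨f⟩⟩ := Finite.exists_equiv_fin A
    exact ⟨fun a => f a, Fin.val_injective.comp f.injective⟩
  let r : A → A → ℕ := fun i j => if j = P i then 0 else if j = P.symm i then 1 else e j + 2
  have hr : ∀ i, Injective (r i) := by
    intro i j k h
    simp only [r] at h
    split_ifs at h <;> first | omega | simp_all [he.eq_iff]
  let I : SRInstance A :=
    { prefers := fun i j k => j ≠ i ∧ k ≠ i ∧ r i j < r i k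
      ne_of_prefers := fun i j k h => ⟨h.1, h.2.1⟩
      irrefl := fun i j h => lt_irrefl _ h.2.2
      trans := fun i j k l h h' => ⟨h.1, h'.2.1, h.2.2.trans h'.2.2⟩
      total := fun i j k hj hk hne => by
        rcases lt_or_gt_of_ne ((hr i).ne hne) with h | h
        · exact Or.inl ⟨hj, hk, h⟩
        · exact Or.inr ⟨hk, hj, h⟩ }
  -- Only the successor beats the predecessor, except at a fixed point, which is ranked last by
  -- itself. A violating pair would therefore consist of two fixed points.
  have hbetter : ∀ i j, I.StrictlyPrefers i j (P.symm i) → j = P i ∨ P i = i := by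
    rintro i j (⟨-, -, h⟩ | ⟨-, h⟩)
    · left
      by_contra hc
      simp only [r, if_neg hc] at h
      split_ifs at h <;> omega
    · exact Or.inr ((Equiv.symm_apply_eq P).mp h).symm
  refine ⟨I, fun i => ?_, ?_⟩
  · by_cases h : P i = P.symm i
    · exact Or.inl h
    · have hi : P i ≠ i := fun hi => h (hi.trans ((Equiv.symm_apply_eq P).mpr hi.symm).symm)
      refine Or.inr (Or.inl ⟨hi, fun h' => hi ((Equiv.symm_apply_eq P).mp h').symm, ?_⟩)
      simp [r, Ne.symm h]
  · rintro ⟨i, j, hij, h1, h2⟩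
    have hne1 := StrictlyPrefers.ne I h1
    have hne2 := StrictlyPrefers.ne I h2
    rcases hbetter i j h1 with rfl | hi
    · simp at hne2
    · rcases hbetter j i h2 with rfl | hj
      · simp at hne1
      · exact hij (hfix i j hi hj)

/-- A single cycle of length `n` or `n - 1`. -/
theorem exists_perm_single_cycle {n m : ℕ} (hm : 2 ≤ m) (hmn : m ≤ n) (hnm : n ≤ m + 1) :
    ∃ P : Equiv.Perm (Fin n), (∀ a b, P a = a → P b = b → a = b) ∧
      (∃ a, minimalPeriod P a = m) ∧ (oddCyclesOf P).ncard ≤ n - m + 1 := by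
  classical
  obtain ⟨P, hP⟩ := (Equiv.Perm.exists_with_cycleType_iff (Fin n) (m := {m})).mpr
    ⟨by simpa using hmn, by simpa using hm⟩
  have hcyc : P.IsCycle := by
    rw [← Equiv.Perm.card_cycleType_eq_one, hP]; simp
  have hsupp : P.support.card = m := by
    rw [← Equiv.Perm.sum_cycleType, hP]; simp
  have hcompl : P.supportᶜ.card = n - m := by
    rw [Finset.card_compl, hsupp, Fintype.card_fin]
  obtain ⟨x, hx⟩ : P.support.Nonempty := Finset.card_pos.mp (by omega)
  have hx' : P x ≠ x := Equiv.Perm.mem_support.mp hx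
  refine ⟨P, fun a b ha hb => ?_, ⟨x, ?_⟩, ?_⟩
  · have h1 : P.supportᶜ.card ≤ 1 := by omega
    exact Finset.card_le_one.mp h1 a (by simpa using ha) b (by simpa using hb)
  · rw [← hsupp, ← hcyc.orderOf]
    refine Nat.dvd_antisymm ?_ ?_
    · refine IsPeriodicPt.minimalPeriod_dvd ?_
      rw [IsPeriodicPt, IsFixedPt, Equiv.Perm.iterate_eq_pow, pow_orderOf_eq_one]
      rfl
    · refine orderOf_dvd_of_pow_eq_one ?_
      rw [hcyc.pow_eq_one_iff' hx', ← Equiv.Perm.iterate_eq_pow]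
      exact iterate_minimalPeriod
  · have hsub : oddCyclesOf P ⊆
        (insert (periodicOrbit P x) (P.supportᶜ.image (periodicOrbit P)) : Finset _) := by
      rintro _ ⟨⟨a, rfl⟩, -⟩
      by_cases ha : a ∈ P.support
      · obtain ⟨i, hi⟩ := (hcyc.sameCycle hx' (Equiv.Perm.mem_support.mp ha)).exists_nat_pow_eq
        rw [Finset.mem_coe, Finset.mem_insert]
        refine Or.inl ((periodicOrbit_eq_iff_exists_iterate P).mpr ⟨i, ?_⟩)
        rw [Equiv.Perm.iterate_eq_pow, hi]
      · rw [Finset.mem_coe, Finset.mem_insert]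
        exact Or.inr (Finset.mem_image_of_mem _ (Finset.mem_compl.mpr ha))
    refine (Set.ncard_le_ncard hsub (Finset.finite_toSet _)).trans ?_
    rw [Set.ncard_coe_finset]
    refine (Finset.card_insert_le _ _).trans ?_
    have := Finset.card_image_le (s := P.supportᶜ) (f := periodicOrbit P)
    omega

/-- A permutation made of as many three-cycles as possible. -/
theorem exists_perm_three_cycles (n : ℕ) :
    ∃ P : Equiv.Perm (Fin n), (∀ a b, P a = a → P b = b → a = b) ∧
      (3 ≤ n → ∃ a, minimalPeriod P a = 3) ∧ n / 3 + n % 3 % 2 ≤ (oddCyclesOf P).ncard := by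
  classical
  -- Rotating the remainder adds nothing, a fixed point or a transposition; only the fixed point is
  -- an odd cycle.
  let T := (Fin (n / 3) × Fin 3) ⊕ Fin (n % 3)
  let P₀ : Equiv.Perm T :=
    Equiv.sumCongr (Equiv.prodCongr (Equiv.refl _) (finRotate 3)) (finRotate (n % 3))
  obtain ⟨e⟩ : Nonempty (T ≃ Fin n) := by
    refine ⟨Fintype.equivOfCardEq ?_⟩
    simp only [T, Fintype.card_sum, Fintype.card_prod, Fintype.card_fin]
    omega
  let P : Equiv.Perm (Fin n) := (e.symm.trans P₀).trans e
  have hP : ∀ x, P (e x) = e (P₀ x) := fun x => by simp [P]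
  have hiter : ∀ k x, P^[k] (e x) = e (P₀^[k] x) := fun k x =>
    ((Semiconj.iterate_right (f := e) (fun y => (hP y).symm) k) x).symm
  have hthree : ∀ i j, minimalPeriod P (e (Sum.inl (i, j))) = 3 := by
    intro i j
    have : Fact (Nat.Prime 3) := ⟨Nat.prime_three⟩
    refine minimalPeriod_eq_prime ?_ ?_
    · rw [IsPeriodicPt, IsFixedPt, hiter]
      congr 1
      fin_cases j <;> rfl
    · rw [IsFixedPt, hP]
      intro h
      have h2 := (Prod.ext_iff.mp (Sum.inl_injective (e.injective h))).2
      revert h2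
      change finRotate 3 j ≠ j
      fin_cases j <;> decide
  refine ⟨P, ?_, fun hn => ⟨e (Sum.inl (⟨0, by omega⟩, 0)), hthree _ _⟩, ?_⟩
  · have hfix : ∀ x, P (e x) = e x → ∃ j : Fin (n % 3), n % 3 = 1 ∧ x = Sum.inr j := by
      rintro (⟨i, j⟩ | j) h
      · have := hthree i j
        rw [minimalPeriod_eq_one_iff_isFixedPt.mpr h] at this
        omega
      · refine ⟨j, ?_, rfl⟩
        rw [hP] at h
        have h2 : finRotate (n % 3) j = j := Sum.inr_injective (e.injective h)
        have h3 : n % 3 < 3 := Nat.mod_lt _ (by norm_num)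
        clear h hiter hthree
        revert h2
        revert j
        clear hP P e P₀ T
        generalize n % 3 = q at h3
        interval_cases q
        · exact fun j => j.elim0
        · exact fun _ _ => rfl
        · decide
    intro a b ha hb
    obtain ⟨x, rfl⟩ := e.surjective a
    obtain ⟨y, rfl⟩ := e.surjective b
    obtain ⟨i, h1, rfl⟩ := hfix x ha
    obtain ⟨j, -, rfl⟩ := hfix y hb
    have hij : i = j := Fin.ext (by omega)
    rw [hij]
  -- One representative per odd cycle: `n % 3 % 2` is one exactly when the remainder is a fixed
  -- point. The map `π` is constant on orbits and tells the representatives apart.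
  · let g : Fin (n / 3) ⊕ Fin (n % 3 % 2) → T :=
      Sum.map (fun i => (i, 0)) (Fin.castLE (Nat.mod_le _ _))
    let π : T → Fin (n / 3) ⊕ Unit := Sum.map Prod.fst fun _ => ()
    have hπ : ∀ x, π (P₀ x) = π x := by rintro (⟨i, j⟩ | j) <;> rfl
    have hπk : ∀ k x, π (P₀^[k] x) = π x := by
      intro k x
      induction k with
      | zero => rfl
      | succ k ih => rw [iterate_succ_apply', hπ, ih]
    have hinj : Injective fun x => periodicOrbit P (e (g x)) := by
      intro x y h
      obtain ⟨k, hk⟩ := (periodicOrbit_eq_iff_exists_iterate P).mp h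
      rw [hiter] at hk
      have h2 := hπk k (g y)
      rw [e.injective hk] at h2
      rcases x with i | i <;> rcases y with j | j
      · exact congrArg Sum.inl (Sum.inl_injective h2)
      · exact absurd h2 (by simp [π, g])
      · exact absurd h2 (by simp [π, g])
      · exact congrArg Sum.inr (Fin.ext (by omega))
    have hsub : Set.range (fun x => periodicOrbit P (e (g x))) ⊆ oddCyclesOf P := by
      rintro _ ⟨x, rfl⟩
      refine ⟨⟨_, rfl⟩, ?_⟩
      rw [periodicOrbit_length]
      rcases x with i | i
      · change Odd (minimalPeriod P (e (Sum.inl (i, 0))))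
        rw [hthree]
        decide
      · have h1 : minimalPeriod P (e (g (Sum.inr i))) = 1 := by
          rw [minimalPeriod_eq_one_iff_isFixedPt, IsFixedPt, hP]
          congr 1
          change (Sum.inr _ : T) = Sum.inr _
          congr 1
          have hi := i.isLt
          have hsub : Subsingleton (Fin (n % 3)) := Fin.subsingleton_iff_le_one.mpr (by omega)
          exact Subsingleton.elim _ _
        rw [h1]
        exact odd_one
    have hfin : (oddCyclesOf P).Finite := by
      rw [oddCyclesOf_eq_coe_filter]; exact Finset.finite_toSet _
    refine le_trans ?_ (Set.ncard_le_ncard hsub hfin)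
    rw [← Set.image_univ, Set.ncard_image_of_injective _ hinj, Set.ncard_univ]
    simp

theorem exists_solvable (n : ℕ) : ∃ I : SRInstance (Fin n), I.Solvable := by
  have hfix : ∀ a b : Fin n, Fin.revPerm a = a → Fin.revPerm b = b → a = b := by
    intro a b ha hb
    simp only [Fin.revPerm_apply, Fin.ext_iff, Fin.val_rev] at ha hb ⊢
    omega
  obtain ⟨I, hI⟩ := exists_instance_isStablePartition Fin.revPerm hfix
  refine ⟨I, hI.solvable_iff.mpr fun a hodd => ?_⟩
  by_contra hne
  exact apply_apply_ne_of_odd_minimalPeriod hodd hne (Fin.rev_rev a)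

end Construction

end SRInstance

/-! ### Assembly of the bounds and the extremal instances. -/

open SRInstance in
theorem mainTheorem1 (n : ℕ) (hn : 2 ≤ n) :
    (∀ (A : Type*) [Fintype A], Fintype.card A = n → ∀ I : SRInstance A,
      -- the set of odd cycles is well defined
      (∃ P : Equiv.Perm A, I.IsStablePartition P) ∧
      (∀ P : Equiv.Perm A, I.IsStablePartition P →
        SRInstance.oddCyclesOf P = I.oddCycles) ∧
      -- the bounds
      (I.Solvable →
        (Even n → I.oddCycles.ncard = 0) ∧ (Odd n → I.oddCycles.ncard = 1)) ∧
      (¬ I.Solvable →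
        (Even n → 2 ≤ I.oddCycles.ncard) ∧ (Odd n → 1 ≤ I.oddCycles.ncard)) ∧
      I.oddCycles.ncard ≤ n / 3 + (n % 3) % 2) ∧
    -- tightness
    (∃ I : SRInstance (Fin n), I.Solvable) ∧
    (∃ I : SRInstance (Fin n), I.oddCycles.ncard = n / 3 + (n % 3) % 2) ∧
    (3 ≤ n →
      (Even n → ∃ I : SRInstance (Fin n), ¬ I.Solvable ∧ I.oddCycles.ncard = 2) ∧
      (Odd n → ∃ I : SRInstance (Fin n), ¬ I.Solvable ∧ I.oddCycles.ncard = 1) ∧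
      (∃ I : SRInstance (Fin n), ¬ I.Solvable ∧
        I.oddCycles.ncard = n / 3 + (n % 3) % 2)) := by
  have hunsolv : ∀ (P : Equiv.Perm (Fin n)) (I : SRInstance (Fin n)), I.IsStablePartition P →
      ∀ m, Odd m → 3 ≤ m → (∃ a, Function.minimalPeriod P a = m) → ¬ I.Solvable := by
    rintro P I hP m hodd hm ⟨a, ha⟩ h
    have h1 := hP.solvable_iff.mp h a (ha ▸ hodd)
    rw [Function.minimalPeriod_eq_one_iff_isFixedPt.mpr h1] at ha
    omega
  have hupper : ∃ I : SRInstance (Fin n), I.oddCycles.ncard = n / 3 + (n % 3) % 2 ∧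
      (3 ≤ n → ¬ I.Solvable) := by
    obtain ⟨P, hfix, hthree, hcard⟩ := exists_perm_three_cycles n
    obtain ⟨I, hI⟩ := exists_instance_isStablePartition P hfix
    have hle := I.ncard_oddCycles_le
    rw [Fintype.card_fin] at hle
    rw [hI.oddCyclesOf_eq] at hcard
    exact ⟨I, le_antisymm hle hcard, fun h => hunsolv P I hI 3 (by decide) le_rfl (hthree h)⟩
  refine ⟨?_, exists_solvable n, hupper.imp fun I h => h.1, fun h3 => ⟨?_, ?_,
    hupper.imp fun I h => ⟨h.2 h3, h.1⟩⟩⟩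
  · rintro A _ rfl I
    have hpar := I.odd_ncard_oddCycles_iff
    rw [Nat.odd_iff, Nat.odd_iff] at hpar
    refine ⟨I.exists_isStablePartition, fun P hP => hP.oddCyclesOf_eq, fun h => ?_, fun h => ?_,
      I.ncard_oddCycles_le⟩
    · have := h.ncard_oddCycles_le_one
      rw [Nat.even_iff, Nat.odd_iff]
      omega
    · have := one_le_ncard_oddCycles h
      rw [Nat.even_iff, Nat.odd_iff]
      omega
  · intro heven
    -- An odd cycle of length `n - 1 ≥ 3` and one fixed point: at most two odd cycles, and by
    -- unsolvability and parity no fewer.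
    obtain ⟨P, hfix, hper, hcard⟩ := exists_perm_single_cycle (n := n) (m := n - 1)
      (by omega) (by omega) (by omega)
    obtain ⟨I, hI⟩ := exists_instance_isStablePartition P hfix
    rw [Nat.even_iff] at heven
    have hns := hunsolv P I hI (n - 1) (by rw [Nat.odd_iff]; omega) (by omega) hper
    have h1 := one_le_ncard_oddCycles hns
    have hpar := I.odd_ncard_oddCycles_iff
    rw [Nat.odd_iff, Nat.odd_iff, Fintype.card_fin] at hpar
    rw [hI.oddCyclesOf_eq] at hcard
    exact ⟨I, hns, by omega⟩
  · intro hodd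
    obtain ⟨P, hfix, hper, hcard⟩ := exists_perm_single_cycle (n := n) (m := n)
      (by omega) le_rfl (by omega)
    obtain ⟨I, hI⟩ := exists_instance_isStablePartition P hfix
    have hns := hunsolv P I hI n hodd h3 hper
    have h1 := one_le_ncard_oddCycles hns
    rw [hI.oddCyclesOf_eq] at hcard
    exact ⟨I, hns, by omega⟩
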